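/- Let $n \ge 1$, and call a family $\mathcal{F}$ of permutations of $[n] = \{1,\dots,n\}$ intersecting if for all $\sigma, \pi \in \mathcal{F}$ there exists $i \in [n]$ with $\sigma(i) = \pi(i)$. If $\mathcal{F}$ is an intersecting family of permutations of $[n]$, then $|\mathcal{F}| \le (n-1)!$. Moreover, equality holds if and only if $\mathcal{F}$ is canonically intersecting, i.e. there exist $i, j \in [n]$ such that $\mathcal{F}$ is the set of all permutations $\sigma$ of $[n]$ with $\sigma(i) = j$. -/

import Mathlib

open scoped Nat

/-- A family of permutations of an `n`-element set is intersecting if any two of its members agree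
at some point, i.e. the graphs `{(i, σ i)}` of any two members share an element. -/
def IsIntersectingPerm {n : ℕ} (F : Finset (Equiv.Perm (Fin n))) : Prop :=
  ∀ σ ∈ F, ∀ π ∈ F, ∃ i : Fin n, σ i = π i

/-- The family of all permutations of an `n`-element set whose graph contains the pair `(i, j)`. -/
def permStar {n : ℕ} (i j : Fin n) : Finset (Equiv.Perm (Fin n)) :=
  Finset.univ.filter fun σ => σ i = j

/-- A family is canonically intersecting if it consists of all permutations whose graph contains
one fixed pair `(i, j)`. -/
def IsCanonicallyIntersectingPerm {n : ℕ} (F : Finset (Equiv.Perm (Fin n))) : Prop :=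
  ∃ i j : Fin n, F = permStar i j

/-! The translates of a Latin square cover all permutations equally often, and an intersecting
family contains at most one row of each. This gives the bound; at equality, every Latin square has
exactly one row in `F`. Exchanging two rows for two others that fill the same cells then yields, for
the indicator `f` of `F`, f(σ) + f(σab) = f(σa) + f(σb) whenever a and b have complementary
fixed-point sets (`IsLatinWeight.switch`). For n ≥ 4 this is transferred to disjoint transpositions
a, b (`IsLatinWeight.swap_mul_swap`).

At y ∈ F call a pair {i, j} bad if y(i j) ∉ F. The relation rules out disjoint bad pairs and keeps a
bad pair bad when passing from y to yx with x fixing i and j. Comparing suitable members of `F` that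
agree nowhere, one bad pair forces a center v, all of whose pairs are bad. The center survives
transpositions avoiding v, so `F` contains every permutation agreeing with y at v, and cardinalities
finish. For n ≤ 3, `F` has at most two members and lies in a star. -/

open Equiv Finset

/-! ### Latin squares and the bound -/

section LatinSquares

variable {α : Type*} [Fintype α] [DecidableEq α]

/-- A set of permutations is discordant if distinct members disagree at every point. -/
def IsDiscordant (C : Finset (Perm α)) : Prop :=
  ∀ σ ∈ C, ∀ π ∈ C, σ ≠ π → ∀ i, σ i ≠ π i

/-- A Latin square, viewed as the set of its rows: a discordant set of the maximal size. -/
def IsLatinSquare (C : Finset (Perm α)) : Prop :=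
  IsDiscordant C ∧ C.card = Fintype.card α

/-- Hall's theorem: each position has exactly n - |R| unused values and each value at most that many
free positions, so double counting gives Hall's condition. -/
theorem IsDiscordant.exists_discordant_perm {R : Finset (Perm α)} (hR : IsDiscordant R)
    (hc : R.card < Fintype.card α) : ∃ π : Perm α, ∀ σ ∈ R, ∀ i, σ i ≠ π i := by
  classical
  let t : α → Finset α := fun i => univ \ R.image (fun σ => σ i)
  have hmem : ∀ i p, p ∈ t i ↔ ∀ σ ∈ R, σ i ≠ p := by
    intro i p
    simp [t]
  have hcard : ∀ i, (t i).card = Fintype.card α - R.card := by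
    intro i
    rw [card_sdiff_of_subset (subset_univ _), card_univ, card_image_of_injOn]
    intro σ hσ π hπ h
    by_contra hne
    exact hR σ hσ π hπ hne i h
  have hcol : ∀ (S : Finset α) p,
      (S.filter fun i => p ∈ t i).card ≤ Fintype.card α - R.card := by
    intro S p
    have hsub : (S.filter fun i => p ∈ t i) ⊆ univ \ R.image (fun σ => σ⁻¹ p) := by
      intro i hi
      rw [mem_filter, hmem] at hi
      simp only [mem_sdiff, mem_univ, true_and, mem_image, not_exists, not_and]
      rintro σ hσ rfl
      exact hi.2 σ hσ (by simp)
    refine (card_le_card hsub).trans ?_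
    rw [card_sdiff_of_subset (subset_univ _), card_univ, card_image_of_injOn]
    intro σ hσ π hπ h
    by_contra hne
    refine hR σ hσ π hπ hne (σ⁻¹ p) ?_
    have h' : σ⁻¹ p = π⁻¹ p := h
    exact (Perm.eq_inv_iff_eq.1 rfl).trans (Perm.eq_inv_iff_eq.1 h').symm
  have hall : ∀ S : Finset α, S.card ≤ (S.biUnion t).card := by
    intro S
    have := card_mul_le_card_mul (s := S) (t := S.biUnion t) (fun i p => p ∈ t i)
      (m := Fintype.card α - R.card) (n := Fintype.card α - R.card)
      (fun i hi => by
        rw [← hcard i]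
        refine card_le_card fun p hp => ?_
        rw [mem_bipartiteAbove]
        exact ⟨mem_biUnion.2 ⟨i, hi, hp⟩, hp⟩)
      (fun p _ => hcol S p)
    exact Nat.le_of_mul_le_mul_right this (by omega)
  obtain ⟨g, hg, hgt⟩ := (all_card_le_biUnion_card_iff_exists_injective t).1 hall
  refine ⟨Equiv.ofBijective g (Finite.injective_iff_bijective.1 hg), fun σ hσ i => ?_⟩
  exact (hmem i _).1 (hgt i) σ hσ

theorem IsDiscordant.insert {R : Finset (Perm α)} (hR : IsDiscordant R) {π : Perm α}
    (hπ : ∀ σ ∈ R, ∀ i, σ i ≠ π i) : IsDiscordant (insert π R) := by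
  intro σ hσ τ hτ hne i
  rw [mem_insert] at hσ hτ
  rcases hσ with rfl | hσ <;> rcases hτ with rfl | hτ
  · exact absurd rfl hne
  · exact (hπ τ hτ i).symm
  · exact hπ σ hσ i
  · exact hR σ hσ τ hτ hne i

theorem IsDiscordant.exists_isLatinSquare [Nonempty α] {R : Finset (Perm α)}
    (hR : IsDiscordant R) (hc : R.card ≤ Fintype.card α) : ∃ C, R ⊆ C ∧ IsLatinSquare C := by
  induction h : Fintype.card α - R.card generalizing R with
  | zero => exact ⟨R, Subset.rfl, hR, by omega⟩
  | succ m ih =>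
    obtain ⟨π, hπ⟩ := hR.exists_discordant_perm (by omega)
    have hnot : π ∉ R := fun hmem => hπ π hmem (Classical.arbitrary α) rfl
    have hcard := card_insert_of_notMem hnot
    obtain ⟨C, hC, hL⟩ := ih (hR.insert hπ) (by omega) (by omega)
    exact ⟨C, (subset_insert _ _).trans hC, hL⟩

theorem IsLatinSquare.image_mul_left {C : Finset (Perm α)} (hC : IsLatinSquare C) (τ : Perm α) :
    IsLatinSquare (C.image (τ * ·)) := by
  refine ⟨?_, ?_⟩
  · intro σ' hσ' π' hπ' hne i
    obtain ⟨σ, hσ, rfl⟩ := mem_image.1 hσ'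
    obtain ⟨π, hπ, rfl⟩ := mem_image.1 hπ'
    intro h
    exact hC.1 σ hσ π hπ (fun h => hne (by rw [h])) i (τ.injective h)
  · rw [card_image_of_injective _ (mul_right_injective τ), hC.2]

theorem IsLatinSquare.image_mul_right {C : Finset (Perm α)} (hC : IsLatinSquare C) (τ : Perm α) :
    IsLatinSquare (C.image (· * τ)) := by
  refine ⟨?_, ?_⟩
  · intro σ' hσ' π' hπ' hne i
    obtain ⟨σ, hσ, rfl⟩ := mem_image.1 hσ'
    obtain ⟨π, hπ, rfl⟩ := mem_image.1 hπ'
    exact hC.1 σ hσ π hπ (fun h => hne (by rw [h])) (τ i)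
  · rw [card_image_of_injective _ (mul_left_injective τ), hC.2]

/-- Two members agree somewhere, for every pair of members of the family. -/
def IsIntersectingFamily (F : Finset (Perm α)) : Prop :=
  ∀ σ ∈ F, ∀ π ∈ F, ∃ i, σ i = π i

theorem IsIntersectingFamily.card_inter_le_one {F C : Finset (Perm α)}
    (hF : IsIntersectingFamily F) (hC : IsDiscordant C) : (F ∩ C).card ≤ 1 := by
  rw [card_le_one]
  intro σ hσ π hπ
  rw [mem_inter] at hσ hπ
  by_contra hne
  obtain ⟨i, hi⟩ := hF σ hσ.1 π hπ.1
  exact hC σ hσ.2 π hπ.2 hne i hi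

theorem sum_card_inter_image_mul_left (F C : Finset (Perm α)) :
    ∑ τ : Perm α, (F ∩ C.image (τ * ·)).card = C.card * F.card := by
  have h1 : ∀ τ : Perm α, (F ∩ C.image (τ * ·)).card = ∑ c ∈ C, if τ * c ∈ F then 1 else 0 := by
    intro τ
    rw [inter_comm, ← filter_mem_eq_inter, filter_image,
      card_image_of_injective _ (mul_right_injective τ), card_filter]
  simp_rw [h1]
  rw [sum_comm, ← smul_eq_mul, ← sum_const]
  refine sum_congr rfl fun c _ => ?_
  rw [Fintype.sum_equiv (Equiv.mulRight c) (fun τ => if τ * c ∈ F then 1 else 0)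
    (fun τ => if τ ∈ F then 1 else 0) (fun τ => rfl)]
  simp

theorem IsIntersectingFamily.card_le [Nonempty α] {F : Finset (Perm α)}
    (hF : IsIntersectingFamily F) : F.card ≤ (Fintype.card α - 1)! := by
  obtain ⟨C, -, hC⟩ := IsDiscordant.exists_isLatinSquare (α := α) (R := ∅)
    (fun σ hσ => absurd hσ (notMem_empty σ)) (by simp)
  have h := sum_card_inter_image_mul_left F C
  have h2 : ∑ τ : Perm α, (F ∩ C.image (τ * ·)).card ≤ ∑ τ : Perm α, 1 :=
    sum_le_sum fun τ _ => hF.card_inter_le_one (hC.image_mul_left τ).1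
  rw [h, hC.2, sum_const, card_univ, Fintype.card_perm, smul_eq_mul, mul_one,
    ← Nat.mul_factorial_pred Fintype.card_ne_zero] at h2
  exact Nat.le_of_mul_le_mul_left h2 Fintype.card_pos

theorem IsIntersectingFamily.card_inter_eq_one [Nonempty α] {F C : Finset (Perm α)}
    (hF : IsIntersectingFamily F) (hcard : F.card = (Fintype.card α - 1)!)
    (hC : IsLatinSquare C) : (F ∩ C).card = 1 := by
  have h := sum_card_inter_image_mul_left F C
  have hle : ∀ τ ∈ (univ : Finset (Perm α)), (F ∩ C.image (τ * ·)).card ≤ 1 :=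
    fun τ _ => hF.card_inter_le_one (hC.image_mul_left τ).1
  have h2 : ∑ τ : Perm α, (F ∩ C.image (τ * ·)).card = ∑ τ : Perm α, 1 := by
    rw [h, hC.2, hcard, Nat.mul_factorial_pred Fintype.card_ne_zero, sum_const, card_univ,
      Fintype.card_perm, smul_eq_mul, mul_one]
  have h3 := (sum_eq_sum_iff_of_le hle).1 h2 1 (mem_univ _)
  simpa using h3

end LatinSquares

/-! ### Exchanging two rows of a Latin square -/

section Switching

variable {α : Type*} [Fintype α] [DecidableEq α]

/-- A weighting of the permutations that has total weight one on every Latin square. -/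
def IsLatinWeight (f : Perm α → ℤ) : Prop :=
  ∀ C : Finset (Perm α), IsLatinSquare C → ∑ σ ∈ C, f σ = 1

/-- At each point {σ, σab} and {σa, σb} take the same two values, so either pair completes the same
remaining rows to a Latin square. -/
theorem IsLatinWeight.switch [Nontrivial α] {f : Perm α → ℤ} (hf : IsLatinWeight f)
    (σ a b : Perm α) (hab : ∀ i, (a i = i ∧ b i ≠ i) ∨ (a i ≠ i ∧ b i = i)) :
    f σ + f (σ * a * b) = f (σ * a) + f (σ * b) := by
  have ha : ∀ i, a i = i → a (b i) = b i := by
    intro i hi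
    rcases hab i with ⟨-, h⟩ | ⟨h, -⟩
    · rcases hab (b i) with ⟨h', -⟩ | ⟨-, h'⟩
      · exact h'
      · exact absurd (b.injective h') h
    · exact absurd hi h
  have hval : ∀ i, ((σ * a) i = σ i ∧ (σ * b) i = (σ * a * b) i ∧ σ i ≠ (σ * a * b) i) ∨
      ((σ * a) i = (σ * a * b) i ∧ (σ * b) i = σ i ∧ σ i ≠ (σ * a * b) i) := by
    intro i
    simp only [Perm.mul_apply, EmbeddingLike.apply_eq_iff_eq, ne_eq]
    rcases hab i with ⟨h, h'⟩ | ⟨h, h'⟩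
    · left
      exact ⟨h, (ha i h).symm, by rw [ha i h]; exact Ne.symm h'⟩
    · right
      exact ⟨by rw [h'], h', by rw [h']; exact Ne.symm h⟩
  have i₀ : α := Classical.arbitrary α
  have hne : ∀ π τ : Perm α, (∀ i, π i ≠ τ i) → π ≠ τ := fun π τ h e => h i₀ (by rw [e])
  have hd1 : ∀ i, σ i ≠ (σ * a * b) i := fun i => by
    rcases hval i with h | h <;> exact h.2.2
  have hd2 : ∀ i, (σ * a) i ≠ (σ * b) i := fun i => by
    rcases hval i with ⟨h1, h2, h3⟩ | ⟨h1, h2, h3⟩ <;> rw [h1, h2]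
    · exact h3
    · exact h3.symm
  have hR : IsDiscordant ({σ, σ * a * b} : Finset (Perm α)) := by
    have h1 : IsDiscordant ({σ * a * b} : Finset (Perm α)) := by
      intro π hπ τ hτ hne
      rw [mem_singleton] at hπ hτ
      exact absurd (hπ.trans hτ.symm) hne
    refine h1.insert fun π hπ i => ?_
    rw [mem_singleton.1 hπ]
    exact (hd1 i).symm
  have hRcard := card_pair (hne _ _ hd1)
  obtain ⟨C, hRC, hC⟩ := hR.exists_isLatinSquare
    (by rw [hRcard]; exact Fintype.one_lt_card)
  have hσC : σ ∈ C := hRC (by simp)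
  have hτC : σ * a * b ∈ C := hRC (by simp)
  set D := C \ {σ, σ * a * b} with hD
  have hDC : ∀ π ∈ D, ∀ i, π i ≠ σ i ∧ π i ≠ (σ * a * b) i := by
    intro π hπ i
    rw [hD, mem_sdiff, mem_insert, mem_singleton, not_or] at hπ
    exact ⟨hC.1 π hπ.1 σ hσC hπ.2.1 i, hC.1 π hπ.1 _ hτC hπ.2.2 i⟩
  have hb : ∀ π ∈ D, ∀ i, π i ≠ (σ * b) i := by
    intro π hπ i
    rcases hval i with ⟨-, h, -⟩ | ⟨-, h, -⟩ <;> rw [h]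
    · exact (hDC π hπ i).2
    · exact (hDC π hπ i).1
  have ha' : ∀ π ∈ D, ∀ i, π i ≠ (σ * a) i := by
    intro π hπ i
    rcases hval i with ⟨h, -, -⟩ | ⟨h, -, -⟩ <;> rw [h]
    · exact (hDC π hπ i).1
    · exact (hDC π hπ i).2
  have hDdis : IsDiscordant D := fun π hπ τ hτ =>
    hC.1 π (sdiff_subset hπ) τ (sdiff_subset hτ)
  have hbD : ∀ π ∈ insert (σ * b) D, ∀ i, π i ≠ (σ * a) i := by
    intro π hπ i
    rcases mem_insert.1 hπ with rfl | hπ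
    · exact (hd2 i).symm
    · exact ha' π hπ i
  have hnb : σ * b ∉ D := fun h => hb _ h i₀ rfl
  have hna : σ * a ∉ insert (σ * b) D := fun h => hbD _ h i₀ rfl
  have hsub : ({σ, σ * a * b} : Finset (Perm α)) ⊆ C := hRC
  have hDcard : D.card + 2 = C.card := by
    rw [hD, ← hRcard, card_sdiff_add_card_eq_card hsub]
  have hC' : IsLatinSquare (insert (σ * a) (insert (σ * b) D)) := by
    refine ⟨(hDdis.insert hb).insert hbD, ?_⟩
    rw [card_insert_of_notMem hna, card_insert_of_notMem hnb, ← hC.2, ← hDcard]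
  have e1 := hf _ hC
  have e2 := hf _ hC'
  rw [sum_insert hna, sum_insert hnb] at e2
  rw [← sum_sdiff hsub, sum_pair (hne _ _ hd1)] at e1
  linarith

end Switching

/-! ### The relation for disjoint transpositions -/

/-- Combine the relation at τ with the one at τbc, where bcb = c returns the terms to the quadrangle
of τ. -/
theorem quadrangle_translate {α : Type*} {f : Perm α → ℤ} {a b c : Perm α}
    (hs : ∀ τ, f τ + f (τ * a * b) = f (τ * a) + f (τ * b))
    (hab : a * b = b * a) (hac : a * c = c * a) (hbc : b * c * b = c) (τ : Perm α) :
    f (τ * b) + f (τ * b * a * c) - f (τ * b * a) - f (τ * b * c) =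
      f τ + f (τ * a * c) - f (τ * a) - f (τ * c) := by
  have h1 := hs τ
  have h2 := hs (τ * b * c)
  have e1 : τ * a * b = τ * b * a := by rw [mul_assoc, hab, mul_assoc]
  have e2 : τ * b * c * b = τ * c := by rw [mul_assoc, mul_assoc, ← mul_assoc b, hbc]
  have e3 : τ * b * c * a = τ * b * a * c := by
    rw [mul_assoc _ c a, ← hac, ← mul_assoc]
  have e4 : τ * b * a * c * b = τ * a * c := by
    rw [← e1, mul_assoc (τ * a), mul_assoc (τ * a), hbc]
  rw [e3, e2, e4] at h2
  rw [e1] at h1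
  linarith

section Quadrangles

variable {α : Type*} [Fintype α] [DecidableEq α]

theorem exists_perm_apply_eq_iff_notMem {S : Finset α} (hS : S.Nontrivial) :
    ∃ b : Perm α, ∀ i, b i = i ↔ i ∉ S := by
  obtain ⟨b, hb, hsupp⟩ := S.exists_cycleOn
  refine ⟨b, fun i => ⟨fun h hi => hb.apply_ne hS hi h, fun hi => ?_⟩⟩
  by_contra h
  exact hi (hsupp (Perm.mem_support.2 h))

theorem IsLatinWeight.translate {f : Perm α → ℤ} (hf : IsLatinWeight f) (σ τ : Perm α) :
    IsLatinWeight fun π => f (σ * π * τ) := by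
  intro C hC
  have h := hf _ ((hC.image_mul_left σ).image_mul_right τ)
  rwa [sum_image fun _ _ _ _ h => mul_left_injective τ h,
    sum_image fun _ _ _ _ h => mul_right_injective σ h] at h

theorem IsLatinWeight.swap_mul_swap_of_card_eq_four {f : Perm α → ℤ} (hf : IsLatinWeight f)
    (h4 : Fintype.card α = 4) (σ : Perm α) {i j k l : α} (h : [i, j, k, l].Nodup) :
    f σ + f (σ * swap i j * swap k l) = f (σ * swap i j) + f (σ * swap k l) := by
  have : Nontrivial α := Fintype.one_lt_card_iff_nontrivial.1 (by omega)
  have hS : ({i, j, k, l} : Finset α) = univ := by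
    rw [← card_eq_iff_eq_univ, h4]
    simpa using List.toFinset_card_of_nodup h
  refine hf.switch σ _ _ fun m => ?_
  have hm : m ∈ ({i, j, k, l} : Finset α) := hS ▸ mem_univ m
  simp only [List.nodup_cons, List.mem_cons, not_or] at h
  simp only [mem_insert, mem_singleton] at hm
  simp only [swap_apply_def]
  grind

/-- Reach (k l) as b · b⁻¹(k l), where both factors fix exactly i and j, and add the two switches.
-/
theorem IsLatinWeight.swap_mul_swap_of_six_le_card {f : Perm α → ℤ} (hf : IsLatinWeight f)
    (h6 : 6 ≤ Fintype.card α) (σ : Perm α) {i j k l : α} (h : [i, j, k, l].Nodup) :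
    f σ + f (σ * swap i j * swap k l) = f (σ * swap i j) + f (σ * swap k l) := by
  have : Nontrivial α := Fintype.one_lt_card_iff_nontrivial.1 (by omega)
  have hne := h
  simp only [List.nodup_cons, List.mem_cons, not_or] at hne
  obtain ⟨w, hw⟩ : ∃ w : Perm α, ∀ x, w x = x ↔ x ∉ ({i, j, l}ᶜ : Finset α) := by
    refine exists_perm_apply_eq_iff_notMem (one_lt_card_iff_nontrivial.1 ?_)
    have := card_le_three (a := i) (b := j) (c := l)
    rw [card_compl]
    omega
  simp only [mem_compl, mem_insert, mem_singleton, not_not] at hw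
  -- Inserting l into a cycle of w before p gives b l = w p, so p must avoid w⁻¹ k; this uses the
  -- sixth point.
  obtain ⟨p, hp⟩ : ∃ p, p ∉ ({i, j, k, l, w⁻¹ k} : Finset α) := by
    by_contra! hall
    have h1 : (univ : Finset α) ⊆ {i, j, k, l, w⁻¹ k} := fun x _ => hall x
    have := (card_le_card h1).trans card_le_five
    rw [card_univ] at this
    omega
  simp only [mem_insert, mem_singleton, not_or, Perm.eq_inv_iff_eq] at hp
  set b : Perm α := w * swap l p with hb
  have hbx : ∀ x, b x = if x = l then w p else if x = p then l else w x := by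
    intro x
    rw [hb, Perm.mul_apply, swap_apply_def]
    have := (hw l).2 (by simp)
    split_ifs <;> simp [this]
  have hfix : ∀ x, b x = x ↔ x = i ∨ x = j := by
    intro x
    rw [hbx]
    have := w.injective.eq_iff (a := x) (b := l)
    have := w.injective.eq_iff (a := p) (b := l)
    have := hw l
    have := hw x
    grind
  have hbk : b k ≠ l := by
    rw [hbx]
    have := w.injective.eq_iff (a := k) (b := l)
    have := hw l
    grind
  have hbl : b l ≠ k := by
    rw [hbx]
    grind
  have hbi : b i = i := (hfix i).2 (Or.inl rfl)
  have hbj : b j = j := (hfix j).2 (Or.inr rfl)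
  have hcomm : swap i j * b = b * swap i j := by
    rw [mul_swap_eq_swap_mul, hbi, hbj]
  have h1 := hf.switch σ (swap i j) b fun x => by
    have := hfix x
    simp only [swap_apply_def]
    grind
  have h2 := hf.switch (σ * b) (swap i j) (b⁻¹ * swap k l) fun x => by
    have h3 := hfix x
    have h4 : (b⁻¹ * swap k l) x = x ↔ b x = swap k l x := by
      rw [Perm.mul_apply, Perm.inv_eq_iff_eq, eq_comm]
    rw [ne_eq, ne_eq, h4]
    simp only [swap_apply_def]
    grind
  have e1 : σ * b * swap i j = σ * swap i j * b := by rw [mul_assoc, ← hcomm, mul_assoc]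
  have e2 : σ * swap i j * b * (b⁻¹ * swap k l) = σ * swap i j * swap k l := by group
  have e3 : σ * b * (b⁻¹ * swap k l) = σ * swap k l := by group
  rw [e1, e2, e3] at h2
  linarith

theorem isLatinSquare_powers {z : Perm α} (hz : z.IsCycleOn (univ : Finset α)) [Nonempty α] :
    Set.InjOn (fun t => z ^ t) (range (Fintype.card α) : Set ℕ) ∧
      IsLatinSquare ((range (Fintype.card α)).image fun t => z ^ t) := by
  have key : ∀ s ∈ range (Fintype.card α), ∀ t ∈ range (Fintype.card α), ∀ x,
      (z ^ s) x = (z ^ t) x → s = t := by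
    intro s hs t ht x hx
    have := (hz.pow_apply_eq_pow_apply (mem_univ x)).1 hx
    rw [card_univ] at this
    exact Nat.ModEq.eq_of_lt_of_lt this (mem_range.1 hs) (mem_range.1 ht)
  have hinj : Set.InjOn (fun t => z ^ t) (range (Fintype.card α) : Set ℕ) := by
    intro s hs t ht h
    exact key s hs t ht (Classical.arbitrary α) (by rw [show z ^ s = z ^ t from h])
  refine ⟨hinj, ?_, by rw [card_image_of_injOn hinj, card_range]⟩
  intro σ hσ π hπ hne x hx
  obtain ⟨s, hs, rfl⟩ := mem_image.1 hσ
  obtain ⟨t, ht, rfl⟩ := mem_image.1 hπ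
  exact hne (by rw [key s hs t ht x hx])

/-- On three points b and b⁻¹(k l) cannot both be derangements. Instead, the defect of the relation
is invariant under the 3-cycles u and b, hence under the 5-cycle z = ub; summing over the Latin
square of powers of z gives 5 · defect = 1 + 1 - 1 - 1. -/
theorem IsLatinWeight.swap_mul_swap_of_card_eq_five {f : Perm α → ℤ} (hf : IsLatinWeight f)
    (h5 : Fintype.card α = 5) (σ : Perm α) {i j k l : α} (h : [i, j, k, l].Nodup) :
    f σ + f (σ * swap i j * swap k l) = f (σ * swap i j) + f (σ * swap k l) := by
  have : Nontrivial α := Fintype.one_lt_card_iff_nontrivial.1 (by omega)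
  obtain ⟨m, hm⟩ : ∃ m, m ∉ ({i, j, k, l} : Finset α) := by
    by_contra! hall
    have h1 : (univ : Finset α) ⊆ {i, j, k, l} := fun x _ => hall x
    have := (card_le_card h1).trans card_le_four
    rw [card_univ] at this
    omega
  simp only [mem_insert, mem_singleton, not_or] at hm
  have hnd : [i, j, m, k, l].Nodup := by
    simp only [List.nodup_cons, List.mem_cons, not_or] at h ⊢
    grind
  have hS : ([i, j, m, k, l].toFinset : Finset α) = univ := by
    rw [← card_eq_iff_eq_univ, h5, List.toFinset_card_of_nodup hnd]
    rfl
  have hall : ∀ x, x = i ∨ x = j ∨ x = m ∨ x = k ∨ x = l := by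
    intro x
    have : x ∈ ([i, j, m, k, l].toFinset : Finset α) := hS ▸ mem_univ x
    simpa using this
  have hne := hnd
  simp only [List.nodup_cons, List.mem_cons, not_or] at hne
  set a := swap i j with ha
  set c := swap k l with hc
  set u := a * swap j m with hu
  set b := swap m k * c with hb
  have hac : a * c = c * a := (Perm.disjoint_swap_swap h).commute
  have hab : a * b = b * a := by
    have h1 : a * swap m k = swap m k * a :=
      (Perm.disjoint_swap_swap (by simp only [List.nodup_cons, List.mem_cons, not_or]; grind)).commute
    rw [hb, ← mul_assoc, h1, mul_assoc, hac, mul_assoc]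
  have hcu : c * u = u * c := by
    have h1 : swap j m * c = c * swap j m :=
      (Perm.disjoint_swap_swap (by simp only [List.nodup_cons, List.mem_cons, not_or]; grind)).commute
    rw [hu, ← mul_assoc, ← hac, mul_assoc, ← h1, mul_assoc]
  have hbc : b * c * b = c := by
    rw [hb, mul_assoc (swap m k), swap_mul_self, mul_one, ← mul_assoc, swap_mul_self, one_mul]
  have hua : u * a * u = a := by
    rw [hu, mul_assoc (a * swap j m), ← mul_assoc a a, swap_mul_self, one_mul, mul_assoc,
      swap_mul_self, mul_one]
  have hsb : ∀ τ, f τ + f (τ * a * b) = f (τ * a) + f (τ * b) := fun τ =>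
    hf.switch τ a b fun x => by
      have hx := hall x
      simp only [ha, hb, hc, Perm.mul_apply, swap_apply_def]
      grind
  have hsu : ∀ τ, f τ + f (τ * c * u) = f (τ * c) + f (τ * u) := fun τ =>
    hf.switch τ c u fun x => by
      have hx := hall x
      simp only [ha, hu, hc, Perm.mul_apply, swap_apply_def]
      grind
  set z := u * b with hz
  have hcyc : z.IsCycleOn (univ : Finset α) := by
    have h1 := hnd.isCycleOn_formPerm
    have h2 : [i, j, m, k, l].formPerm = z := by
      simp only [List.formPerm_cons_cons, List.formPerm_singleton, mul_one, hz, hu, hb, ha, hc,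
        mul_assoc]
    rw [h2] at h1
    convert h1 using 1
    ext x
    simpa using hall x
  have hE : ∀ τ, f (τ * z) + f (τ * z * a * c) - f (τ * z * a) - f (τ * z * c) =
      f τ + f (τ * a * c) - f (τ * a) - f (τ * c) := by
    intro τ
    have h1 := quadrangle_translate hsb hab hac hbc (τ * u)
    have h2 := quadrangle_translate hsu hcu hac.symm hua τ
    have e : ∀ τ : Perm α, τ * c * a = τ * a * c := fun τ => by
      rw [mul_assoc, ← hac, mul_assoc]
    rw [e, e] at h2
    rw [hz, ← mul_assoc]
    linarith
  have hpow : ∀ t : ℕ, f (σ * z ^ t) + f (σ * z ^ t * (a * c)) - f (σ * z ^ t * a) -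
      f (σ * z ^ t * c) = f σ + f (σ * a * c) - f (σ * a) - f (σ * c) := by
    intro t
    induction t with
    | zero => simp [mul_assoc]
    | succ t ih =>
      have := hE (σ * z ^ t)
      rw [← ih, pow_succ, ← mul_assoc, ← mul_assoc, ← mul_assoc]
      exact this
  obtain ⟨hinj, hC⟩ := isLatinSquare_powers hcyc
  have hsum : ∀ x, ∑ t ∈ range 5, f (σ * z ^ t * x) = 1 := by
    intro x
    have := hf.translate σ x _ hC
    rwa [sum_image hinj, h5] at this
  have h0 := hsum 1
  simp only [mul_one] at h0
  have htot := sum_congr (s₁ := range 5) rfl fun t _ => hpow t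
  rw [sum_sub_distrib, sum_sub_distrib, sum_add_distrib, h0, hsum, hsum, hsum, sum_const,
    card_range] at htot
  simp only [nsmul_eq_mul] at htot
  push_cast at htot
  linarith

theorem IsLatinWeight.swap_mul_swap {f : Perm α → ℤ} (hf : IsLatinWeight f)
    (h4 : 4 ≤ Fintype.card α) (σ : Perm α) {i j k l : α} (h : [i, j, k, l].Nodup) :
    f σ + f (σ * swap i j * swap k l) = f (σ * swap i j) + f (σ * swap k l) := by
  obtain h' | h' | h' : Fintype.card α = 4 ∨ Fintype.card α = 5 ∨ 6 ≤ Fintype.card α := by omega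
  · exact hf.swap_mul_swap_of_card_eq_four h' σ h
  · exact hf.swap_mul_swap_of_card_eq_five h' σ h
  · exact hf.swap_mul_swap_of_six_le_card h' σ h

end Quadrangles

/-! ### From the relation to a star -/

section Stars

variable {α : Type*} [Fintype α] [DecidableEq α]

/-- Such x is a product of transpositions disjoint from (i j), and each preserves the difference. -/
theorem swap_difference_mul {f : Perm α → ℤ}
    (hQ : ∀ σ, ∀ {i j k l : α}, [i, j, k, l].Nodup →
      f σ + f (σ * swap i j * swap k l) = f (σ * swap i j) + f (σ * swap k l))
    {i j : α} (hij : i ≠ j) (σ x : Perm α) (hi : x i = i) (hj : x j = j) :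
    f (σ * x) - f (σ * x * swap i j) = f σ - f (σ * swap i j) := by
  have key : ∀ e : Perm {m // m ≠ i ∧ m ≠ j}, f (σ * Perm.ofSubtype e) -
      f (σ * Perm.ofSubtype e * swap i j) = f σ - f (σ * swap i j) := by
    intro e
    induction e using Perm.swap_induction_on' with
    | one => simp
    | mul_swap g p q hpq ih =>
      rw [← ih, map_mul, Perm.ofSubtype_swap_eq, ← mul_assoc]
      have hne : (p : α) ≠ q := fun h => hpq (Subtype.ext h)
      have hnd : [i, j, (p : α), (q : α)].Nodup := by
        have := p.2
        have := q.2
        simp only [List.nodup_cons, List.mem_cons, not_or]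
        grind
      have h := hQ (σ * Perm.ofSubtype g) hnd
      rw [mul_assoc _ (swap (p : α) q), ← (Perm.disjoint_swap_swap hnd).commute.eq, ← mul_assoc]
      linarith
  have hp : ∀ m, x m ≠ i ∧ x m ≠ j ↔ m ≠ i ∧ m ≠ j := by
    intro m
    have h1 := x.injective.eq_iff (a := m) (b := i)
    have h2 := x.injective.eq_iff (a := m) (b := j)
    rw [hi] at h1
    rw [hj] at h2
    rw [ne_eq, ne_eq, h1, h2]
  have h := key (x.subtypePerm hp)
  rwa [Perm.ofSubtype_subtypePerm _ (fun m hm => ⟨fun h => hm (h ▸ hi), fun h => hm (h ▸ hj)⟩)] at h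

/-- The indicator function of the family satisfies the relation
`f σ + f (σ a b) = f (σ a) + f (σ b)` for all disjoint transpositions `a` and `b`. -/
def IsQuadrangular (F : Finset (Perm α)) : Prop :=
  ∀ σ, ∀ {i j k l : α}, [i, j, k, l].Nodup →
    (if σ ∈ F then 1 else 0 : ℤ) + (if σ * swap i j * swap k l ∈ F then 1 else 0) =
      (if σ * swap i j ∈ F then 1 else 0) + (if σ * swap k l ∈ F then 1 else 0)

theorem IsIntersectingFamily.isQuadrangular {F : Finset (Perm α)}
    (hF : IsIntersectingFamily F) (hcard : F.card = (Fintype.card α - 1)!)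
    (h4 : 4 ≤ Fintype.card α) : IsQuadrangular F := by
  have : Nonempty α := Fintype.card_pos_iff.1 (by omega)
  have hw : IsLatinWeight fun σ => (if σ ∈ F then 1 else 0 : ℤ) := by
    intro C hC
    have := hF.card_inter_eq_one hcard hC
    rw [sum_boole, filter_mem_eq_inter, inter_comm, this, Nat.cast_one]
  exact fun σ _ _ _ _ h => hw.swap_mul_swap h4 σ h

namespace IsQuadrangular

variable {F : Finset (Perm α)} (hF : IsQuadrangular F)
include hF

theorem mul_mem_of_swap_notMem {y x : Perm α} (hy : y ∈ F) {i j : α} (hij : i ≠ j)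
    (h : y * swap i j ∉ F) (hi : x i = i) (hj : x j = j) :
    y * x ∈ F ∧ y * x * swap i j ∉ F := by
  have := swap_difference_mul hF hij y x hi hj
  rw [if_pos hy, if_neg h] at this
  split_ifs at this with h1 h2 <;> simp_all

theorem mul_swap_mem {y x : Perm α} (hy : y ∈ F) {i j : α} (hij : i ≠ j)
    (h : y * swap i j ∈ F) (hi : x i = i) (hj : x j = j) (hx : y * x ∈ F) :
    y * x * swap i j ∈ F := by
  have := swap_difference_mul hF hij y x hi hj
  rw [if_pos hy, if_pos h, if_pos hx] at this
  split_ifs at this with h1 <;> simp_all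

theorem swap_mem_or_swap_mem {y : Perm α} (hy : y ∈ F) {i j k l : α} (h : [i, j, k, l].Nodup) :
    y * swap i j ∈ F ∨ y * swap k l ∈ F := by
  have := hF y h
  rw [if_pos hy] at this
  by_contra! hcon
  rw [if_neg hcon.1, if_neg hcon.2] at this
  split_ifs at this <;> omega

theorem swap_notMem_of_swap_mem (hI : IsIntersectingFamily F) {y : Perm α} (hy : y ∈ F)
    {i j k l : α} (h : [i, j, k, l].Nodup) (hij : y * swap i j ∉ F) (hik : y * swap i k ∈ F) :
    y * swap j l ∉ F := by
  intro hjl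
  simp only [List.nodup_cons, List.mem_cons, not_or] at h
  obtain ⟨w, hw⟩ : ∃ w : Perm α, ∀ x, (x = i ∨ x = j ∨ x = k → w x = x) ∧
      (¬(x = i ∨ x = j ∨ x = k) → x ≠ l → w x ≠ x) := by
    by_cases hS : ({i, j, k}ᶜ : Finset α).Nontrivial
    · obtain ⟨w, hw⟩ := exists_perm_apply_eq_iff_notMem hS
      refine ⟨w, fun x => ?_⟩
      have := hw x
      simp only [mem_compl, mem_insert, mem_singleton, not_not] at this
      exact ⟨this.2, fun h _ => h ∘ this.1⟩
    -- Here n = 4: only l lies outside {i, j, k}, and it need not move.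
    · refine ⟨1, fun x => ⟨fun _ => rfl, fun hx hxl => ?_⟩⟩
      refine absurd ⟨x, ?_, l, ?_, hxl⟩ hS
      · simp only [coe_compl, Set.mem_compl_iff, mem_coe, mem_insert, mem_singleton]
        exact hx
      · simp only [coe_compl, Set.mem_compl_iff, mem_coe, mem_insert, mem_singleton]
        grind
  have hwi := (hw i).1 (by simp)
  have hwj := (hw j).1 (by simp)
  have hwk := (hw k).1 (by simp)
  have h1 := (hF.mul_mem_of_swap_notMem hy h.1.1 hij hwi hwj).1
  have h2 := hF.mul_swap_mem hy h.1.2.1 hik hwi hwk h1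
  obtain ⟨x, hx⟩ := hI _ hjl _ h2
  have hwl := w.injective.eq_iff (a := l) (b := j)
  have hwx := hw x
  simp only [Perm.mul_apply, EmbeddingLike.apply_eq_iff_eq, swap_apply_def] at hx
  grind

/-- Since {j, k} is bad, y(i l) ∈ `F`; either continuation from it agrees nowhere with yw or yu. -/
theorem not_triangle (hI : IsIntersectingFamily F) {y : Perm α} (hy : y ∈ F)
    {i j k l : α} (h : [i, j, k, l].Nodup) (hij : y * swap i j ∉ F) (hik : y * swap i k ∉ F)
    (hjk : y * swap j k ∉ F) : False := by
  have hne := h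
  simp only [List.nodup_cons, List.mem_cons, not_or] at hne
  have hz : y * swap i l ∈ F :=
    (hF.mul_mem_of_swap_notMem hy hne.2.1.1 hjk (swap_apply_of_ne_of_ne (by grind) (by grind))
      (swap_apply_of_ne_of_ne (by grind) (by grind))).1
  obtain ⟨u, hu⟩ : ∃ u : Perm α, ∀ x, u x = x ↔ x ∉ ({i, k}ᶜ : Finset α) :=
    exists_perm_apply_eq_iff_notMem ⟨j, by simp; grind, l, by simp; grind, by grind⟩
  obtain ⟨w, hw⟩ : ∃ w : Perm α, ∀ x, w x = x ↔ x ∉ ({i, j}ᶜ : Finset α) :=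
    exists_perm_apply_eq_iff_notMem ⟨k, by simp; grind, l, by simp; grind, by grind⟩
  simp only [mem_compl, mem_insert, mem_singleton, not_not] at hu hw
  have hui := (hu i).2 (by simp)
  have huk := (hu k).2 (by simp)
  have hwi := (hw i).2 (by simp)
  have hwj := (hw j).2 (by simp)
  have h1 := (hF.mul_mem_of_swap_notMem hy hne.1.2.1 hik hui huk).1
  have h2 := (hF.mul_mem_of_swap_notMem hy hne.1.1 hij hwi hwj).1
  rcases hF.swap_mem_or_swap_mem hz h with h3 | h3
  · obtain ⟨x, hx⟩ := hI _ h3 _ h2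
    have hwl := w.injective.eq_iff (a := l) (b := i)
    have hwx := hw x
    simp only [Perm.mul_apply, EmbeddingLike.apply_eq_iff_eq, swap_apply_def] at hx
    grind
  · obtain ⟨x, hx⟩ := hI _ h3 _ h1
    have hul := u.injective.eq_iff (a := l) (b := k)
    have hux := hu x
    simp only [Perm.mul_apply, EmbeddingLike.apply_eq_iff_eq, swap_apply_def] at hx
    grind

theorem exists_center (hI : IsIntersectingFamily F) (h4 : 4 ≤ Fintype.card α) {y : Perm α}
    (hy : y ∈ F) {i j : α} (hij : i ≠ j) (h : y * swap i j ∉ F) :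
    ∃ v, ∀ w, w ≠ v → y * swap v w ∉ F := by
  by_cases hall : ∀ w, w ≠ i → y * swap i w ∉ F
  · exact ⟨i, hall⟩
  push Not at hall
  obtain ⟨k, hki, hk⟩ := hall
  have hkj : k ≠ j := fun e => h (e ▸ hk)
  have hstep : ∀ k m, k ≠ i → k ≠ j → m ≠ i → m ≠ j → m ≠ k → y * swap i k ∈ F →
      y * swap j m ∉ F := by
    intro k m h1 h2 h3 h4 h5 hk
    refine hF.swap_notMem_of_swap_mem hI hy ?_ h hk
    simp only [List.nodup_cons, List.mem_cons, not_or]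
    grind
  refine ⟨j, fun m hm => ?_⟩
  by_cases hmi : m = i
  · rwa [hmi, swap_comm]
  by_cases hmk : m = k
  · subst hmk
    obtain ⟨l, hl⟩ : ∃ l, l ∉ ({i, j, m} : Finset α) := by
      by_contra! hcon
      have h1 : (univ : Finset α) ⊆ {i, j, m} := fun x _ => hcon x
      have := (card_le_card h1).trans card_le_three
      rw [card_univ] at this
      omega
    simp only [mem_insert, mem_singleton, not_or] at hl
    have hjl := hstep m l hki hkj hl.1 hl.2.1 hl.2.2 hk
    have hil : y * swap i l ∈ F := by
      by_contra hil
      refine hF.not_triangle hI hy (i := i) (j := j) (k := l) (l := m) ?_ h hil hjl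
      simp only [List.nodup_cons, List.mem_cons, not_or]
      grind
    exact hstep l m hl.1 hl.2.1 hmi hm (Ne.symm hl.2.2) hil
  · exact hstep k m hki hkj hmi hm hmk hk

theorem center_mul_swap (hI : IsIntersectingFamily F) (h4 : 4 ≤ Fintype.card α) {y : Perm α}
    (hy : y ∈ F) {v k l : α} (hv : ∀ w, w ≠ v → y * swap v w ∉ F) (hkl : k ≠ l) (hk : k ≠ v)
    (hl : l ≠ v) : y * swap k l ∈ F ∧ ∀ w, w ≠ v → y * swap k l * swap v w ∉ F := by
  have hout : ∀ w, w ≠ v → w ≠ k → w ≠ l →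
      y * swap k l ∈ F ∧ y * swap k l * swap v w ∉ F := fun w h1 h2 h3 =>
    hF.mul_mem_of_swap_notMem hy h1.symm (hv w h1)
      (swap_apply_of_ne_of_ne hk.symm hl.symm) (swap_apply_of_ne_of_ne h2 h3)
  -- Otherwise y(k l)(v k) would agree nowhere with yu, where u fixes exactly v and k.
  have hin : ∀ k l, k ≠ l → k ≠ v → l ≠ v → y * swap k l * swap v k ∉ F := by
    intro k l hkl hk hl hmem
    obtain ⟨u, hu⟩ : ∃ u : Perm α, ∀ x, u x = x ↔ x ∉ ({v, k}ᶜ : Finset α) := by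
      refine exists_perm_apply_eq_iff_notMem (one_lt_card_iff_nontrivial.1 ?_)
      have := card_le_two (a := v) (b := k)
      rw [card_compl]
      omega
    simp only [mem_compl, mem_insert, mem_singleton, not_not] at hu
    have huv := (hu v).2 (by simp)
    have huk := (hu k).2 (by simp)
    have h1 := (hF.mul_mem_of_swap_notMem hy hk.symm (hv k hk) huv huk).1
    obtain ⟨x, hx⟩ := hI _ hmem _ h1
    have hul := u.injective.eq_iff (a := l) (b := k)
    have hux := hu x
    simp only [Perm.mul_apply, EmbeddingLike.apply_eq_iff_eq, swap_apply_def] at hx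
    grind
  obtain ⟨m, hm⟩ : ∃ m, m ∉ ({v, k, l} : Finset α) := by
    by_contra! hcon
    have h1 : (univ : Finset α) ⊆ {v, k, l} := fun x _ => hcon x
    have := (card_le_card h1).trans card_le_three
    rw [card_univ] at this
    omega
  simp only [mem_insert, mem_singleton, not_or] at hm
  refine ⟨(hout m hm.1 hm.2.1 hm.2.2).1, fun w hw => ?_⟩
  by_cases hwk : w = k
  · rw [hwk]
    exact hin k l hkl hk hl
  by_cases hwl : w = l
  · rw [hwl, swap_comm k l]
    exact hin l k hkl.symm hl hk
  · exact (hout w hw hwk hwl).2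

theorem mul_mem_of_center (hI : IsIntersectingFamily F) (h4 : 4 ≤ Fintype.card α) {y : Perm α}
    (hy : y ∈ F) {v : α} (hv : ∀ w, w ≠ v → y * swap v w ∉ F) {x : Perm α} (hx : x v = v) :
    y * x ∈ F := by
  have key : ∀ e : Perm {m // m ≠ v}, y * Perm.ofSubtype e ∈ F ∧
      ∀ w, w ≠ v → y * Perm.ofSubtype e * swap v w ∉ F := by
    intro e
    induction e using Perm.swap_induction_on' with
    | one => simpa using ⟨hy, hv⟩
    | mul_swap g p q hpq ih =>
      rw [map_mul, Perm.ofSubtype_swap_eq, ← mul_assoc]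
      exact hF.center_mul_swap hI h4 ih.1 ih.2 (fun h => hpq (Subtype.ext h)) p.2 q.2
  have hp : ∀ m, x m ≠ v ↔ m ≠ v := by
    intro m
    have h1 := x.injective.eq_iff (a := m) (b := v)
    rw [hx] at h1
    rw [ne_eq, h1]
  have h := (key (x.subtypePerm hp)).1
  convert h using 2
  exact (Perm.ofSubtype_subtypePerm (p := fun m => m ≠ v) hp
    fun m hm h => hm (by rw [h, hx])).symm

theorem exists_filter_subset (hI : IsIntersectingFamily F) (h4 : 4 ≤ Fintype.card α)
    (hne : F.Nonempty) (huniv : F ≠ univ) :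
    ∃ i j, (univ.filter fun σ : Perm α => σ i = j) ⊆ F := by
  obtain ⟨y, hy, i, j, hij, h⟩ : ∃ y ∈ F, ∃ i j, i ≠ j ∧ y * swap i j ∉ F := by
    by_contra! hcon
    obtain ⟨y, hy⟩ := hne
    refine huniv (eq_univ_of_forall fun σ => ?_)
    have key : ∀ x, y * x ∈ F := by
      intro x
      induction x using Perm.swap_induction_on' with
      | one => simpa using hy
      | mul_swap g p q hpq ih =>
        rw [← mul_assoc]
        exact hcon _ ih p q hpq
    simpa using key (y⁻¹ * σ)
  obtain ⟨v, hv⟩ := hF.exists_center hI h4 hy hij h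
  refine ⟨v, y v, fun σ hσ => ?_⟩
  have := hF.mul_mem_of_center hI h4 hy hv (x := y⁻¹ * σ) (by
    rw [Perm.mul_apply, (mem_filter.1 hσ).2, Perm.inv_eq_iff_eq])
  simpa using this

end IsQuadrangular

end Stars

/-! ### Size of stars, small cases and conclusion -/

/-- The n stars at i partition n! permutations and each obeys the bound, so each attains it. -/
theorem card_permStar {n : ℕ} (i j : Fin n) : (permStar i j).card = (n - 1)! := by
  have : Nonempty (Fin n) := ⟨i⟩
  have hle : ∀ k ∈ (univ : Finset (Fin n)), (permStar i k).card ≤ (n - 1)! := by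
    intro k _
    have h : IsIntersectingFamily (permStar i k) := fun σ hσ π hπ =>
      ⟨i, (mem_filter.1 hσ).2.trans (mem_filter.1 hπ).2.symm⟩
    simpa using h.card_le
  have hsum : ∑ k : Fin n, (permStar i k).card = ∑ k : Fin n, (n - 1)! := by
    have h := card_eq_sum_card_fiberwise (s := (univ : Finset (Perm (Fin n)))) (t := univ)
      (f := fun σ => σ i) (fun _ _ => by simp)
    rw [card_univ, Fintype.card_perm, Fintype.card_fin,
      ← Nat.mul_factorial_pred (Fin.pos i).ne'] at h
    rw [sum_const, card_univ, Fintype.card_fin, smul_eq_mul]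
    exact h.symm
  exact (sum_eq_sum_iff_of_le hle).1 hsum j (mem_univ j)

theorem exists_subset_permStar_of_card_le_two {n : ℕ} {F : Finset (Perm (Fin n))}
    (hF : IsIntersectingPerm F) (hne : F.Nonempty) (h2 : F.card ≤ 2) :
    ∃ i j, F ⊆ permStar i j := by
  obtain h | h : F.card = 1 ∨ F.card = 2 := by
    have := hne.card_pos
    omega
  · obtain ⟨σ, rfl⟩ := card_eq_one.1 h
    obtain ⟨i, -⟩ := hF σ (by simp) σ (by simp)
    exact ⟨i, σ i, by simp [permStar]⟩
  · obtain ⟨σ, π, -, rfl⟩ := card_eq_two.1 h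
    obtain ⟨i, hi⟩ := hF σ (by simp) π (by simp)
    refine ⟨i, σ i, fun τ hτ => ?_⟩
    rw [mem_insert, mem_singleton] at hτ
    rcases hτ with rfl | rfl
    · simp [permStar]
    · simp [permStar, hi]

theorem mainTheorem10 (n : ℕ) (hn : 1 ≤ n) (F : Finset (Equiv.Perm (Fin n)))
    (hF : IsIntersectingPerm F) :
    F.card ≤ (n - 1)! ∧ (F.card = (n - 1)! ↔ IsCanonicallyIntersectingPerm F) := by
  have hI : IsIntersectingFamily F := hF
  have : Nonempty (Fin n) := ⟨⟨0, hn⟩⟩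
  refine ⟨by simpa using hI.card_le, fun hcard => ?_, ?_⟩
  · have hne : F.Nonempty := by
      rw [← card_pos, hcard]
      exact Nat.factorial_pos _
    by_cases h4 : 4 ≤ n
    · have h4' : 4 ≤ Fintype.card (Fin n) := by simpa using h4
      have huniv : F ≠ univ := by
        rintro rfl
        rw [card_univ, Fintype.card_perm, Fintype.card_fin] at hcard
        exact absurd hcard ((Nat.factorial_lt (by omega)).2 (by omega)).ne'
      obtain ⟨i, j, hij⟩ := (hI.isQuadrangular (by simpa using hcard) h4').exists_filter_subset
        hI h4' hne huniv
      exact ⟨i, j, (eq_of_subset_of_card_le hij (by rw [hcard, ← card_permStar i j]; rfl)).symm⟩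
    · have h2 : F.card ≤ 2 := by
        rw [hcard]
        exact Nat.factorial_le (m := n - 1) (n := 2) (by omega)
      obtain ⟨i, j, hij⟩ := exists_subset_permStar_of_card_le_two hF hne h2
      exact ⟨i, j, eq_of_subset_of_card_le hij (by rw [hcard, card_permStar])⟩
  · rintro ⟨i, j, rfl⟩
    exact card_permStar i j
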